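/- Let $R$ be a commutative ring and let $t\in R$ (for instance $R=\mathbb{Z}[t]$ with $t$ an indeterminate). Let $M$ be a natural number with $M+1\equiv 2$ or $3 \pmod 5$, and write $[M+1]_q=1+q+\cdots+q^M$. Then, as an identity of formal power series in $R[[q]]$, where $\frac1f$ denotes the inverse of a power series $f$ with constant term $1$, and where the infinite sum and the infinite product converge coefficientwise (every coefficient is eventually constant), $$ \begin{aligned} 1&+q^2\,\frac{1+q+\cdots+q^{M-2}+tq^{M-1}+q^M}{1-tq^{M+1}} +\sum_{k=2}^{M}\frac{q^{k(k+1)}}{(1-q^2)(1-q^3)\cdots(1-q^k)}\,\frac{[M+1]_q}{1-tq^{M+1}}\\ &+\sum_{k=M+1}^{\infty}\frac{q^{k(k+1)}}{(1-q)\cdots(1-q^M)\,(1-tq^{M+1})\,(1-q^{M+2})\cdots(1-q^k)}\\ &=\frac{1-q^{M+1}}{1-tq^{M+1}}\;\frac{1}{\prod_{k=0}^{\infty}(1-q^{5k+2})(1-q^{5k+3})}. \end{aligned} $$ Here the sum over $2\le k\le M$ and the sum $1+q+\cdots+q^{M-2}$ are empty when $M=1$. -/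

import Mathlib

open PowerSeries
open scoped PowerSeries.WithPiTopology

/-- The reciprocal `1 / f` of a formal power series `f` with constant coefficient `1`. -/
noncomputable def recip {R : Type*} [CommRing R] (f : R⟦X⟧) : R⟦X⟧ :=
  invOfUnit f 1

theorem mul_recip {R : Type*} [CommRing R] (f : R⟦X⟧) (hf : constantCoeff f = 1) :
    f * recip f = 1 :=
  mul_invOfUnit f 1 (by simpa using hf)

/-- The polynomial `[n]_q = 1 + q + ⋯ + q ^ (n - 1)`; the variable `q` is `PowerSeries.X`. -/
noncomputable def qBracket (R : Type*) [CommRing R] (n : ℕ) : R⟦X⟧ :=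
  ∑ i ∈ Finset.range n, (X : R⟦X⟧) ^ i

/-- `∏ (1 - q ^ j)` over `a ≤ j ≤ b`, the empty product `1` if `b < a`. -/
noncomputable def qProd (R : Type*) [CommRing R] (a b : ℕ) : R⟦X⟧ :=
  ∏ j ∈ Finset.Icc a b, (1 - (X : R⟦X⟧) ^ j)

/-- The factor `1 - t q ^ n`. -/
noncomputable def weightedFactor {R : Type*} [CommRing R] (t : R) (n : ℕ) : R⟦X⟧ :=
  1 - C t * X ^ n

/-- The two factors `(1 - q ^ (5 k + 2)) (1 - q ^ (5 k + 3))`. -/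
noncomputable def rrFactor (R : Type*) [CommRing R] (k : ℕ) : R⟦X⟧ :=
  (1 - X ^ (5 * k + 2)) * (1 - X ^ (5 * k + 3))

/-- The numerator `1 + q + ⋯ + q ^ (M - 2) + t q ^ (M - 1) + q ^ M`, for `M ≥ 1`. -/
noncomputable def firstNumerator {R : Type*} [CommRing R] (t : R) (M : ℕ) : R⟦X⟧ :=
  qBracket R (M - 1) + C t * X ^ (M - 1) + X ^ M

/-- The term of index `k` for `2 ≤ k ≤ M`:
`q ^ (k (k + 1)) / ((1 - q ^ 2) ⋯ (1 - q ^ k)) * [M + 1]_q / (1 - t q ^ (M + 1))`. -/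
noncomputable def middleTerm {R : Type*} [CommRing R] (t : R) (M k : ℕ) : R⟦X⟧ :=
  X ^ (k * (k + 1)) * recip (qProd R 2 k) *
    (qBracket R (M + 1) * recip (weightedFactor t (M + 1)))

/-- The term of index `k` for `k ≥ M + 1`: `q ^ (k (k + 1))` over
`(1 - q) ⋯ (1 - q ^ M) (1 - t q ^ (M + 1)) (1 - q ^ (M + 2)) ⋯ (1 - q ^ k)`. -/
noncomputable def tailTerm {R : Type*} [CommRing R] (t : R) (M k : ℕ) : R⟦X⟧ :=
  X ^ (k * (k + 1)) *
    recip (qProd R 1 M * weightedFactor t (M + 1) * qProd R (M + 2) k)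

open Filter Topology

/-! ### Reciprocals, coefficientwise limits and recurrences in `R⟦X⟧`. -/

section Basics

variable {R : Type*} [CommRing R]

/-! Write `G_n = ∑ q^(k(k+n)) / (q)_k`. The left side is `(1 - q^(M+1)) / (1 - t q^(M+1))` times
`G_1`: this holds term by term for `k ≥ 2` (`middleTerm_eq`, `tailTerm_eq`) and for `k = 0, 1`
jointly (`initial_terms_eq`). What remains is the second Rogers-Ramanujan identity,
`tsum_rrTerm_one`.

That identity is proved by Rogers' method. Both `G_n` and the series `T_n = ∑ rogersTwo n r` satisfy
`D_n = D_(n+1) + q^(n+1) D_(n+2)`. As `n → ∞`, `G_n → 1` and `T_n → (q)_∞`, and a solution tending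
to `0` vanishes (`eq_zero_of_recurrence`), so `(q)_∞ G_n = T_n`. For `n = 1` the right side is a
theta series, which the Jacobi triple product (`tsum_thetaTerm`) turns into the product over
exponents `0, ±1` mod `5`. Cancelling it from `(q)_∞` leaves the exponents `2, 3` mod `5`. -/

theorem eq_recip_of_mul_eq_one {f g : R⟦X⟧} (hf : constantCoeff f = 1) (h : f * g = 1) :
    g = recip f := by
  calc g = g * (f * recip f) := by rw [mul_recip f hf, mul_one]
    _ = f * g * recip f := by ring
    _ = recip f := by rw [h, one_mul]

theorem recip_mul {f g : R⟦X⟧} (hf : constantCoeff f = 1) (hg : constantCoeff g = 1) :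
    recip (f * g) = recip f * recip g := by
  refine (eq_recip_of_mul_eq_one (by simp [hf, hg]) ?_).symm
  linear_combination recip g * g * mul_recip f hf + mul_recip g hg

theorem constantCoeff_one_sub_X_pow {n : ℕ} (hn : n ≠ 0) :
    constantCoeff (1 - X ^ n : R⟦X⟧) = 1 := by
  simp [hn]

theorem constantCoeff_prod_eq_one {ι : Type*} (s : Finset ι) (f : ι → R⟦X⟧)
    (h : ∀ i ∈ s, constantCoeff (f i) = 1) : constantCoeff (∏ i ∈ s, f i) = 1 := by
  rw [map_prod, Finset.prod_eq_one h]

variable [TopologicalSpace R]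

theorem summable_of_X_pow_dvd {g : ℕ → R⟦X⟧} (h : ∀ r, X ^ r ∣ g r) : Summable g := by
  rw [WithPiTopology.summable_iff_summable_coeff]
  intro d
  refine summable_of_ne_finset_zero (s := Finset.range (d + 1)) fun r hr => ?_
  exact X_pow_dvd_iff.1 (h r) d (by simpa using hr)

theorem coeff_tsum_of_X_pow_dvd [T2Space R] {g : ℕ → R⟦X⟧} (h : ∀ r, X ^ r ∣ g r) (d : ℕ) :
    coeff d (∑' r, g r) = ∑ r ∈ Finset.range (d + 1), coeff d (g r) := by
  refine (((WithPiTopology.hasSum_iff_hasSum_coeff R).1 (summable_of_X_pow_dvd h).hasSum) d).unique ?_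
  exact hasSum_sum_of_ne_finset_zero fun r hr => X_pow_dvd_iff.1 (h r) d (by simpa using hr)

/-- Tannery's theorem: the coefficient of `q^d` involves only the terms `r ≤ d`, uniformly in `n`.
-/
theorem tendsto_tsum_of_X_pow_dvd [T2Space R] [ContinuousAdd R] {f : ℕ → ℕ → R⟦X⟧} {g : ℕ → R⟦X⟧}
    (hf : ∀ n r, X ^ r ∣ f n r) (hg : ∀ r, X ^ r ∣ g r)
    (h : ∀ r, Tendsto (fun n => f n r) atTop (𝓝 (g r))) :
    Tendsto (fun n => ∑' r, f n r) atTop (𝓝 (∑' r, g r)) := by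
  rw [WithPiTopology.tendsto_iff_coeff_tendsto]
  intro d
  simp only [coeff_tsum_of_X_pow_dvd (hf _), coeff_tsum_of_X_pow_dvd hg]
  exact tendsto_finsetSum _ fun r _ =>
    (WithPiTopology.tendsto_iff_coeff_tendsto R _ _ _).1 (h r) d

theorem multipliable_one_sub_X_pow_mul_add (a : ℕ) {b : ℕ} (ha : a ≠ 0) :
    Multipliable fun k => (1 : R⟦X⟧) - X ^ (a * k + b) := by
  nontriviality R
  simp_rw [sub_eq_add_neg]
  refine WithPiTopology.multipliable_one_add_of_tendsto_order_atTop_nhds_top R (ι := ℕ) ?_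
  refine ENat.tendsto_nhds_top_iff_natCast_lt.mpr fun n => eventually_atTop.2 ⟨n + 1, fun m hm => ?_⟩
  rw [order_neg, order_X_pow]
  norm_cast
  nlinarith [Nat.pos_of_ne_zero ha]

variable [DiscreteTopology R]

theorem tendsto_iff_eventually_X_pow_dvd_sub {F : ℕ → R⟦X⟧} {f : R⟦X⟧} :
    Tendsto F atTop (𝓝 f) ↔ ∀ N, ∀ᶠ n in atTop, X ^ N ∣ F n - f := by
  rw [WithPiTopology.tendsto_iff_coeff_tendsto]
  simp only [nhds_discrete, tendsto_pure, X_pow_dvd_iff, map_sub, sub_eq_zero]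
  constructor
  · intro h N
    have := (eventually_all_finset (Finset.range N)).2 fun d _ => h d
    simpa using this
  · intro h d
    filter_upwards [h (d + 1)] with n hn using hn d (by simp)

theorem tendsto_of_forall_X_pow_dvd_sub {F : ℕ → R⟦X⟧} {f : R⟦X⟧}
    (h : ∀ n, X ^ n ∣ F n - f) : Tendsto F atTop (𝓝 f) :=
  tendsto_iff_eventually_X_pow_dvd_sub.2 fun N => by
    filter_upwards [eventually_ge_atTop N] with n hn using (pow_dvd_pow X hn).trans (h n)

theorem tendsto_recip {F : ℕ → R⟦X⟧} {f : R⟦X⟧} (hF : ∀ n, constantCoeff (F n) = 1)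
    (hf : constantCoeff f = 1) (h : Tendsto F atTop (𝓝 f)) :
    Tendsto (fun n => recip (F n)) atTop (𝓝 (recip f)) := by
  rw [tendsto_iff_eventually_X_pow_dvd_sub] at h ⊢
  intro N
  filter_upwards [h N] with n hn
  have : recip (F n) - recip f = (F n - f) * (-(recip (F n) * recip f)) := by
    linear_combination recip f * mul_recip (F n) (hF n) - recip (F n) * mul_recip f hf
  rw [this]
  exact hn.mul_right _

theorem constantCoeff_eq_one_of_tendsto {F : ℕ → R⟦X⟧} {f : R⟦X⟧}
    (hF : ∀ n, constantCoeff (F n) = 1) (h : Tendsto F atTop (𝓝 f)) :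
    constantCoeff f = 1 := by
  obtain ⟨n, hn⟩ := (tendsto_iff_eventually_X_pow_dvd_sub.1 h 1).exists
  rw [pow_one, X_dvd_iff, map_sub, hF, sub_eq_zero] at hn
  exact hn.symm

/-- Uniqueness for the Rogers-Ramanujan recurrence. -/
theorem eq_zero_of_recurrence {D : ℕ → R⟦X⟧}
    (hD : ∀ m, D m = D (m + 1) + X ^ (m + 1) * D (m + 2))
    (h0 : Tendsto D atTop (𝓝 0)) (m : ℕ) : D m = 0 := by
  have key : ∀ d m, coeff d (D m) = 0 := by
    intro d
    induction d using Nat.strong_induction_on with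
    | _ d ih =>
      -- The shifted term contributes only a coefficient of degree below `d`, zero by induction.
      -- Hence the degree `d` coefficient does not depend on `m` and equals its limit `0`.
      have hstep : ∀ m, coeff d (D m) = coeff d (D (m + 1)) := by
        intro m
        rw [hD m, map_add, coeff_X_pow_mul']
        split_ifs with h
        · rw [ih (d - (m + 1)) (by omega), add_zero]
        · rw [add_zero]
      have hconst : ∀ k m, coeff d (D m) = coeff d (D (m + k)) := by
        intro k
        induction k with
        | zero => simp
        | succ k ihk => intro m; rw [ihk, hstep]; rfl
      intro m
      obtain ⟨n, hn⟩ := eventually_atTop.1 (tendsto_iff_eventually_X_pow_dvd_sub.1 h0 (d + 1))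
      rw [hconst n m]
      simpa using X_pow_dvd_iff.1 (hn (m + n) (by omega)) d (by simp)
  ext d
  simpa using key d m

end Basics

/-! ### Rogers' series and the Rogers-Ramanujan recurrence. -/

section RogersSelberg

theorem succ_choose_two (r : ℕ) : (r + 1).choose 2 = r + r.choose 2 := by
  simp [Nat.choose_succ_succ' r 1]

/-- The product `(1 - q ^ (r + 1)) ⋯ (1 - q ^ (r + n))`. -/
noncomputable def shiftedProd (R : Type*) [CommRing R] (n r : ℕ) : R⟦X⟧ :=
  ∏ i ∈ Finset.range n, (1 - X ^ (r + 1 + i))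

variable {R : Type*} [CommRing R]

theorem shiftedProd_succ (n r : ℕ) :
    shiftedProd R (n + 1) r = shiftedProd R n r * (1 - X ^ (r + 1 + n)) :=
  Finset.prod_range_succ _ _

theorem shiftedProd_succ' (n r : ℕ) :
    shiftedProd R (n + 1) r = shiftedProd R n (r + 1) * (1 - X ^ (r + 1)) := by
  unfold shiftedProd
  rw [Finset.prod_range_succ']
  congr 1
  exact Finset.prod_congr rfl fun i _ => by congr 2; omega

/-- The terms of Rogers' series `H₁(q ^ (n + 1))`, multiplied by `∏ (1 - q ^ j)`. -/
noncomputable def rogersOne (R : Type*) [CommRing R] (n r : ℕ) : R⟦X⟧ :=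
  X ^ r * ((-1) ^ r * X ^ (2 * (n + 1) * r + 5 * r.choose 2 + r) *
    (1 - X ^ (n + 1 + 2 * r)) * shiftedProd R n r)

/-- The terms of Rogers' series `H₂(q ^ (n + 1))`, multiplied by `∏ (1 - q ^ j)`. -/
noncomputable def rogersTwo (R : Type*) [CommRing R] (n r : ℕ) : R⟦X⟧ :=
  X ^ r * ((-1) ^ r * X ^ (2 * (n + 1) * r + 5 * r.choose 2) *
    (1 - X ^ (2 * (n + 1) + 4 * r)) * shiftedProd R n r)

/-- The terms of the Rogers-Ramanujan series `∑ q ^ (k (k + n)) / ((1 - q) ⋯ (1 - q ^ k))`. -/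
noncomputable def rrTerm (R : Type*) [CommRing R] (n k : ℕ) : R⟦X⟧ :=
  X ^ (k * (k + n)) * recip (qProd R 1 k)

theorem X_pow_dvd_rogersOne (n r : ℕ) : X ^ r ∣ rogersOne R n r := dvd_mul_right _ _

theorem X_pow_dvd_rogersTwo (n r : ℕ) : X ^ r ∣ rogersTwo R n r := dvd_mul_right _ _

theorem X_pow_dvd_rrTerm (n k : ℕ) : X ^ k ∣ rrTerm R n k :=
  (pow_dvd_pow X (by nlinarith [Nat.zero_le (k * n), Nat.le_mul_self k])).mul_right _

theorem constantCoeff_qProd {a : ℕ} (ha : a ≠ 0) (b : ℕ) : constantCoeff (qProd R a b) = 1 :=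
  constantCoeff_prod_eq_one _ _ fun j hj =>
    constantCoeff_one_sub_X_pow (by have := (Finset.mem_Icc.1 hj).1; omega)

theorem qProd_one_succ (k : ℕ) : qProd R 1 (k + 1) = qProd R 1 k * (1 - X ^ (k + 1)) :=
  Finset.prod_Icc_succ_top (by omega) _

theorem one_sub_mul_recip_qProd_succ (k : ℕ) :
    (1 - X ^ (k + 1)) * recip (qProd R 1 (k + 1)) = recip (qProd R 1 k) := by
  rw [qProd_one_succ, recip_mul (constantCoeff_qProd one_ne_zero k)
    (constantCoeff_one_sub_X_pow (by omega))]
  linear_combination recip (qProd R 1 k) *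
    mul_recip (1 - X ^ (k + 1) : R⟦X⟧) (constantCoeff_one_sub_X_pow (by omega))

variable [TopologicalSpace R]

/-- The infinite product `∏ (1 - q ^ j)` over `j ≥ 1`. -/
noncomputable def eulerProd (R : Type*) [CommRing R] [TopologicalSpace R] : R⟦X⟧ :=
  ∏' i : ℕ, (1 - X ^ (i + 1))

theorem tendsto_eulerProd :
    Tendsto (fun n => ∏ i ∈ Finset.range n, (1 - X ^ (i + 1) : R⟦X⟧)) atTop
      (𝓝 (eulerProd R)) :=
  (WithPiTopology.multipliable_one_sub_X_pow R).hasProd.tendsto_prod_nat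

variable [DiscreteTopology R]

/-- Shifting `A` by one index loses only `A 0 = 0`. The three recurrences below are instances. -/
theorem tsum_eq_tsum_of_telescope {f g A B : ℕ → R⟦X⟧} (hA : ∀ r, X ^ r ∣ A r)
    (hB : ∀ r, X ^ r ∣ B r) (hf : ∀ r, f r = A r + B r) (h0 : A 0 = 0)
    (hg : ∀ r, g r = A (r + 1) + B r) : ∑' r, f r = ∑' r, g r := by
  have sA := summable_of_X_pow_dvd hA
  have sB := summable_of_X_pow_dvd hB
  have sA' : Summable fun r => A (r + 1) :=
    summable_of_X_pow_dvd fun r => (pow_dvd_pow X (by omega)).trans (hA (r + 1))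
  simp_rw [hf, hg]
  rw [sA.tsum_add sB, sA'.tsum_add sB, sA.tsum_eq_zero_add, h0, zero_add]

/-- The splitting is `1 - q^(n+1+2r) = (1 - q^r) + q^r (1 - q^(n+1+r))`; the last factor extends
`shiftedProd` at the top, and `1 - q^r` extends it at the bottom after the shift of `r`. -/
theorem tsum_rogersOne (n : ℕ) : ∑' r, rogersOne R n r = ∑' r, rogersTwo R (n + 1) r := by
  refine tsum_eq_tsum_of_telescope
    (A := fun r => X ^ r * ((-1) ^ r * X ^ (2 * (n + 1) * r + 5 * r.choose 2 + r) *
      (1 - X ^ r) * shiftedProd R n r))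
    (B := fun r => X ^ r * ((-1) ^ r * X ^ (2 * (n + 1) * r + 5 * r.choose 2 + 2 * r) *
      shiftedProd R (n + 1) r))
    (fun r => dvd_mul_right _ _) (fun r => dvd_mul_right _ _) (fun r => ?_) (by simp)
    (fun r => ?_)
  · rw [rogersOne, shiftedProd_succ]
    ring
  · rw [rogersTwo, shiftedProd_succ', succ_choose_two]
    ring

/-- Here the difference of the bracketed factors is `(1 - q^r) + q^(n+1+3r) (1 - q^(n+1+r))`. -/
theorem tsum_rogersTwo (n : ℕ) : ∑' r, rogersTwo R n r =
    ∑' r, rogersOne R n r + X ^ (n + 1) * ∑' r, rogersOne R (n + 1) r := by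
  have s1 := summable_of_X_pow_dvd (X_pow_dvd_rogersOne (R := R) n)
  have s2 := summable_of_X_pow_dvd (X_pow_dvd_rogersTwo (R := R) n)
  have s3 := summable_of_X_pow_dvd (X_pow_dvd_rogersOne (R := R) (n + 1))
  rw [← sub_eq_iff_eq_add', ← s2.tsum_sub s1, ← s3.tsum_mul_left]
  refine tsum_eq_tsum_of_telescope
    (A := fun r => X ^ r * ((-1) ^ r * X ^ (2 * (n + 1) * r + 5 * r.choose 2) *
      (1 - X ^ r) * shiftedProd R n r))
    (B := fun r => X ^ r * ((-1) ^ r * X ^ (2 * (n + 1) * r + 5 * r.choose 2 + (n + 1) + 3 * r) *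
      shiftedProd R (n + 1) r))
    (fun r => dvd_mul_right _ _) (fun r => dvd_mul_right _ _) (fun r => ?_) (by simp)
    (fun r => ?_)
  · rw [rogersOne, rogersTwo, shiftedProd_succ]
    ring
  · rw [rogersOne, shiftedProd_succ', succ_choose_two]
    ring

/-- The difference of the terms for `n` and `n + 1` carries a factor `1 - q^k`, which cancels the
last factor of `(q)_k`; then `k` is shifted. -/
theorem tsum_rrTerm (n : ℕ) : ∑' k, rrTerm R n k =
    ∑' k, rrTerm R (n + 1) k + X ^ (n + 1) * ∑' k, rrTerm R (n + 2) k := by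
  have s1 := summable_of_X_pow_dvd (X_pow_dvd_rrTerm (R := R) n)
  have s2 := summable_of_X_pow_dvd (X_pow_dvd_rrTerm (R := R) (n + 1))
  have s3 := summable_of_X_pow_dvd (X_pow_dvd_rrTerm (R := R) (n + 2))
  rw [← sub_eq_iff_eq_add', ← s1.tsum_sub s2, ← s3.tsum_mul_left]
  refine tsum_eq_tsum_of_telescope (A := fun k => (1 - X ^ k) * rrTerm R n k) (B := fun _ => 0)
    (fun k => (X_pow_dvd_rrTerm n k).mul_left _) (fun _ => dvd_zero _) (fun k => ?_) (by simp)
    (fun k => ?_)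
  · rw [rrTerm, rrTerm]
    ring
  · rw [rrTerm, rrTerm, ← one_sub_mul_recip_qProd_succ k]
    ring

theorem tendsto_tsum_rrTerm : Tendsto (fun n => ∑' k, rrTerm R n k) atTop (𝓝 1) := by
  rw [← tsum_ite_eq (0 : ℕ) fun _ => (1 : R⟦X⟧)]
  refine tendsto_tsum_of_X_pow_dvd X_pow_dvd_rrTerm (fun k => ?_) fun k => ?_
  · split_ifs with h <;> simp [h]
  · split_ifs with h
    · subst h
      have : recip (qProd R 1 0) = 1 := (eq_recip_of_mul_eq_one (by simp [qProd]) (by simp [qProd])).symm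
      simp [rrTerm, this]
    · refine tendsto_of_forall_X_pow_dvd_sub fun n => ?_
      rw [sub_zero]
      refine (pow_dvd_pow X ?_).mul_right _
      nlinarith [Nat.pos_of_ne_zero h, Nat.zero_le (k * k)]

/-- Only `r = 0` survives in the limit, with term `(1 - q^(2n+2)) (1 - q) ⋯ (1 - q^n)`. -/
theorem tendsto_tsum_rogersTwo :
    Tendsto (fun n => ∑' r, rogersTwo R n r) atTop (𝓝 (eulerProd R)) := by
  rw [← tsum_ite_eq (0 : ℕ) fun _ => eulerProd R]
  refine tendsto_tsum_of_X_pow_dvd X_pow_dvd_rogersTwo (fun k => ?_) fun k => ?_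
  · split_ifs with h <;> simp [h]
  · split_ifs with h
    · subst h
      have h1 : Tendsto (fun n => 1 - X ^ (2 * (n + 1)) : ℕ → R⟦X⟧) atTop (𝓝 1) :=
        tendsto_of_forall_X_pow_dvd_sub fun n =>
          (pow_dvd_pow X (show n ≤ 2 * (n + 1) by omega)).trans (by simp)
      have h2 := h1.mul (tendsto_eulerProd (R := R))
      simpa [rogersTwo, shiftedProd, add_comm] using h2
    · refine tendsto_of_forall_X_pow_dvd_sub fun n => ?_
      rw [sub_zero]
      refine Dvd.dvd.mul_left (((pow_dvd_pow X ?_).mul_left _ |>.mul_right _).mul_right _) _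
      nlinarith [Nat.pos_of_ne_zero h]

/-- Rogers' expansion of the series `∑ q ^ (k (k + n)) / ((1 - q) ⋯ (1 - q ^ k))`. -/
theorem eulerProd_mul_tsum_rrTerm (n : ℕ) :
    eulerProd R * ∑' k, rrTerm R n k = ∑' r, rogersTwo R n r := by
  rw [← sub_eq_zero]
  refine eq_zero_of_recurrence
    (D := fun n => eulerProd R * ∑' k, rrTerm R n k - ∑' r, rogersTwo R n r) (fun m => ?_) ?_ n
  · rw [tsum_rrTerm m, tsum_rogersTwo m, tsum_rogersOne m, tsum_rogersOne (m + 1)]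
    ring
  · simpa using (tendsto_tsum_rrTerm.const_mul (eulerProd R)).sub tendsto_tsum_rogersTwo

end RogersSelberg

/-! ### A finite Jacobi triple product. -/

section TripleProduct

variable {R : Type*} [CommRing R]

/-- The sum of the terms of index `r` and `-1 - r` of Ramanujan's theta series
`∑ (-1) ^ j a ^ (j (j - 1) / 2) b ^ (j (j + 1) / 2)`. -/
def thetaTerm (a b : R) (r : ℕ) : R :=
  (-1) ^ r * (a * b) ^ r.choose 2 * b ^ r * (1 - a ^ (2 * r + 1))

/-- The finite product `(1 - Q) (1 - Q ^ 2) ⋯ (1 - Q ^ n)`. -/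
def qPochhammer (Q : R) (n : ℕ) : R := ∏ i ∈ Finset.range n, (1 - Q ^ (i + 1))

theorem qPochhammer_succ (Q : R) (n : ℕ) :
    qPochhammer Q (n + 1) = qPochhammer Q n * (1 - Q ^ (n + 1)) :=
  Finset.prod_range_succ _ _

theorem constantCoeff_qPochhammer {Q : R⟦X⟧} (hQ : constantCoeff Q = 0) (n : ℕ) :
    constantCoeff (qPochhammer Q n) = 1 :=
  constantCoeff_prod_eq_one _ _ fun i _ => by simp [hQ]

theorem recip_qPochhammer {Q : R⟦X⟧} (hQ : constantCoeff Q = 0) (n : ℕ) :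
    recip (qPochhammer Q n) = recip (qPochhammer Q (n + 1)) * (1 - Q ^ (n + 1)) := by
  have h : constantCoeff (1 - Q ^ (n + 1)) = 1 := by simp [hQ]
  rw [qPochhammer_succ, recip_mul (constantCoeff_qPochhammer hQ n) h]
  linear_combination -recip (qPochhammer Q n) * mul_recip _ h

/-- The coefficient `1 / ((Q)_(n - r) (Q)_(n + 1 + r))`. -/
noncomputable def thetaWeight (Q : R⟦X⟧) (n r : ℕ) : R⟦X⟧ :=
  recip (qPochhammer Q (n - r)) * recip (qPochhammer Q (n + 1 + r))

/-- A closed form for the partial sums of the defect in the recurrence from level `n` to `n + 1`.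
Writing `n = r + s` avoids truncated subtraction. -/
theorem sum_thetaTerm_telescope {a b : R⟦X⟧} (hQ : constantCoeff (a * b) = 0) (r s : ℕ) :
    ∑ i ∈ Finset.range (r + 1), (thetaTerm a b i *
      ((1 - (a * b) ^ (2 * (r + s) + 2)) * (1 - (a * b) ^ (2 * (r + s) + 3)) *
        thetaWeight (a * b) (r + s + 1) i -
      (1 - a * (a * b) ^ (r + s + 1)) * (1 - b * (a * b) ^ (r + s)) *
        thetaWeight (a * b) (r + s) i)) =
    recip (qPochhammer (a * b) (s + 1)) * recip (qPochhammer (a * b) (2 * r + s + 2)) *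
      (1 - (a * b) ^ (s + 1)) *
      ((a * b) ^ (2 * r + s + 2) * (1 - (a * b) ^ s) * thetaTerm a b r -
        (a * b) ^ s * (1 - (a * b) ^ (2 * r + s + 2)) * thetaTerm a b (r + 1)) := by
  induction r generalizing s with
  | zero =>
    simp only [zero_add, Finset.sum_range_one, thetaWeight, Nat.sub_zero, add_zero, mul_zero]
    rw [recip_qPochhammer hQ s, recip_qPochhammer hQ (s + 1)]
    simp only [thetaTerm, Nat.choose_zero_succ, Nat.choose_succ_self]
    ring
  | succ r ih =>
    rw [Finset.sum_range_succ]
    -- The level `n` is kept: `(r + 1, s)` reduces to `(r, s + 1)`.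
    have e : r + 1 + s = r + (s + 1) := by omega
    rw [e, ih (s + 1)]
    simp only [thetaWeight]
    have e1 : r + (s + 1) + 1 - (r + 1) = s + 1 := by omega
    have e2 : r + (s + 1) - (r + 1) = s := by omega
    have e3 : r + (s + 1) + 1 + 1 + (r + 1) = 2 * r + s + 3 + 1 := by omega
    have e4 : r + (s + 1) + 1 + (r + 1) = 2 * r + s + 3 := by omega
    have e5 : 2 * r + (s + 1) + 2 = 2 * r + s + 3 := by omega
    have e6 : 2 * (r + 1) + s + 2 = 2 * r + s + 3 + 1 := by omega
    rw [e1, e2, e3, e4, e5, e6, recip_qPochhammer hQ s, recip_qPochhammer hQ (s + 1),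
      recip_qPochhammer hQ (2 * r + s + 3)]
    simp only [thetaTerm, succ_choose_two]
    ring

/-- A finite form of the Jacobi triple product identity. -/
theorem sum_thetaTerm_mul_qPochhammer {a b : R⟦X⟧} (hQ : constantCoeff (a * b) = 0) (n : ℕ) :
    (∑ r ∈ Finset.range (n + 1), thetaTerm a b r * thetaWeight (a * b) n r) *
      qPochhammer (a * b) (2 * n + 1) =
    (∏ i ∈ Finset.range (n + 1), (1 - a * (a * b) ^ i)) *
      ∏ i ∈ Finset.range n, (1 - b * (a * b) ^ i) := by
  induction n with
  | zero =>
    have h := mul_recip _ (constantCoeff_qPochhammer hQ 1)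
    have h0 : recip (qPochhammer (a * b) 0) = 1 :=
      (eq_recip_of_mul_eq_one (by simp [qPochhammer]) (by simp [qPochhammer])).symm
    simp [thetaTerm, thetaWeight, h0]
    linear_combination (1 - a) * h
  | succ n ih =>
    rw [Finset.prod_range_succ _ (n + 1), Finset.prod_range_succ (fun i => 1 - b * (a * b) ^ i) n]
    -- At `s = 0` one boundary term vanishes; the other is minus the summand of index `n + 1`,
    -- present only at level `n + 1`.
    have hs := sum_thetaTerm_telescope hQ n 0
    simp only [mul_sub (thetaTerm a b _), mul_left_comm (thetaTerm a b _), Finset.sum_sub_distrib,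
      ← Finset.mul_sum, add_zero, zero_add, recip_qPochhammer hQ (2 * n + 2)] at hs
    have hw : thetaWeight (a * b) (n + 1) (n + 1) =
        recip (qPochhammer (a * b) 1) * (1 - a * b) *
          recip (qPochhammer (a * b) (2 * n + 2 + 1)) := by
      rw [thetaWeight, Nat.sub_self, recip_qPochhammer hQ 0, zero_add, pow_one]
      congr 3
      omega
    have hq : qPochhammer (a * b) (2 * (n + 1) + 1) = qPochhammer (a * b) (2 * n + 1) *
        (1 - (a * b) ^ (2 * n + 2)) * (1 - (a * b) ^ (2 * n + 3)) := by
      rw [show 2 * (n + 1) + 1 = 2 * n + 1 + 1 + 1 by omega, qPochhammer_succ, qPochhammer_succ]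
    rw [Finset.sum_range_succ, hw, hq]
    linear_combination qPochhammer (a * b) (2 * n + 1) * hs +
      (1 - a * (a * b) ^ (n + 1)) * (1 - b * (a * b) ^ n) * ih

end TripleProduct

/-! ### The second Rogers-Ramanujan identity. -/

section RogersRamanujan

variable {R : Type*} [CommRing R] [TopologicalSpace R]

/-- The infinite product `∏ (1 - q ^ (5 k + c))` over `k ≥ 0`. -/
noncomputable def modFiveProd (R : Type*) [CommRing R] [TopologicalSpace R] (c : ℕ) : R⟦X⟧ :=
  ∏' k : ℕ, (1 - X ^ (5 * k + c))

theorem tendsto_modFiveProd (c : ℕ) :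
    Tendsto (fun n => ∏ k ∈ Finset.range n, (1 - X ^ (5 * k + c) : R⟦X⟧)) atTop
      (𝓝 (modFiveProd R c)) :=
  (multipliable_one_sub_X_pow_mul_add 5 (by norm_num)).hasProd.tendsto_prod_nat

theorem tendsto_qPochhammer_X_pow_five :
    Tendsto (fun n => qPochhammer (X * X ^ 4 : R⟦X⟧) n) atTop (𝓝 (modFiveProd R 5)) := by
  refine (tendsto_modFiveProd 5).congr fun n => Finset.prod_congr rfl fun k _ => ?_
  ring

variable [DiscreteTopology R]

theorem constantCoeff_modFiveProd {c : ℕ} (hc : c ≠ 0) :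
    constantCoeff (modFiveProd R c) = 1 :=
  constantCoeff_eq_one_of_tendsto
    (fun _ => constantCoeff_prod_eq_one _ _ fun _ _ => constantCoeff_one_sub_X_pow (by omega))
    (tendsto_modFiveProd c)

/-- The Jacobi triple product identity at `a = q`, `b = q ^ 4`. -/
theorem tsum_thetaTerm :
    ∑' r, thetaTerm (X : R⟦X⟧) (X ^ 4) r =
      modFiveProd R 1 * modFiveProd R 4 * modFiveProd R 5 := by
  have hQ : constantCoeff (X * X ^ 4 : R⟦X⟧) = 0 := by simp
  have hdvd : ∀ r, X ^ r ∣ thetaTerm (X : R⟦X⟧) (X ^ 4) r := fun r => by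
    rw [thetaTerm, ← pow_mul]
    exact ((pow_dvd_pow X (by omega)).mul_left _).mul_right _
  have h5 := constantCoeff_modFiveProd (R := R) (c := 5) (by norm_num)
  have hrec := tendsto_recip (constantCoeff_qPochhammer hQ) h5 tendsto_qPochhammer_X_pow_five
  have hweight : ∀ r, Tendsto (fun n => thetaWeight (X * X ^ 4 : R⟦X⟧) n r) atTop
      (𝓝 (recip (modFiveProd R 5) * recip (modFiveProd R 5))) := fun r =>
    (hrec.comp (tendsto_sub_atTop_nat r)).mul
      (hrec.comp (tendsto_atTop_mono (fun n => by simp only [id]; omega) tendsto_id :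
        Tendsto (fun n => n + 1 + r) atTop atTop))
  have hsum : Tendsto (fun n => ∑ r ∈ Finset.range (n + 1), thetaTerm (X : R⟦X⟧) (X ^ 4) r *
      thetaWeight (X * X ^ 4) n r) atTop (𝓝 (∑' r, thetaTerm (X : R⟦X⟧) (X ^ 4) r *
        (recip (modFiveProd R 5) * recip (modFiveProd R 5)))) := by
    have := tendsto_tsum_of_X_pow_dvd
      (f := fun n r => if r ∈ Finset.range (n + 1) then
        thetaTerm (X : R⟦X⟧) (X ^ 4) r * thetaWeight (X * X ^ 4) n r else 0)
      (g := fun r => thetaTerm (X : R⟦X⟧) (X ^ 4) r *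
        (recip (modFiveProd R 5) * recip (modFiveProd R 5)))
      (fun n r => by
        split_ifs
        exacts [(hdvd r).mul_right _, dvd_zero _])
      (fun r => (hdvd r).mul_right _)
      (fun r => ((hweight r).const_mul _).congr' (by
        filter_upwards [eventually_ge_atTop r] with n hn
        rw [if_pos (Finset.mem_range.2 (by omega))]))
    refine this.congr fun n => ?_
    rw [tsum_eq_sum (s := Finset.range (n + 1)) fun r hr => if_neg hr]
    exact Finset.sum_congr rfl fun r hr => if_pos hr
  rw [(summable_of_X_pow_dvd hdvd).tsum_mul_right] at hsum
  have hodd : Tendsto (fun n => 2 * n + 1) atTop atTop :=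
    tendsto_atTop_mono (fun n => by simp only [id]; omega) tendsto_id
  have hl := hsum.mul (tendsto_qPochhammer_X_pow_five.comp hodd)
  have hr := ((tendsto_modFiveProd (R := R) 1).comp (tendsto_add_atTop_nat 1)).mul
    (tendsto_modFiveProd (R := R) 4)
  have key := tendsto_nhds_unique hl (hr.congr fun n => by
    rw [Function.comp_apply, Function.comp_apply, sum_thetaTerm_mul_qPochhammer hQ n]
    congr 1 <;> exact Finset.prod_congr rfl fun k _ => by ring)
  have h := mul_recip _ h5
  -- With `P = modFiveProd R 5`, `key` reads `θ P⁻² P = modFiveProd R 1 * modFiveProd R 4`;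
  -- multiplying by `P` isolates `θ`.
  linear_combination modFiveProd R 5 * key -
    (∑' r, thetaTerm (X : R⟦X⟧) (X ^ 4) r) * (1 + modFiveProd R 5 * recip (modFiveProd R 5)) * h

theorem multipliable_rrFactor : Multipliable fun k => rrFactor R k :=
  (multipliable_one_sub_X_pow_mul_add 5 (by norm_num)).mul
    (multipliable_one_sub_X_pow_mul_add 5 (by norm_num))

theorem tprod_rrFactor : ∏' k, rrFactor R k = modFiveProd R 2 * modFiveProd R 3 :=
  (multipliable_one_sub_X_pow_mul_add 5 (by norm_num)).tprod_mul
    (multipliable_one_sub_X_pow_mul_add 5 (by norm_num))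

/-- The first `5n` Euler factors are the first `n` factors of each residue class mod `5`. -/
theorem eulerProd_eq_modFiveProd : eulerProd R = modFiveProd R 1 * modFiveProd R 2 *
    modFiveProd R 3 * modFiveProd R 4 * modFiveProd R 5 := by
  have h5 : Tendsto (fun n => 5 * n) atTop atTop :=
    tendsto_atTop_mono (fun n => by simp only [id]; omega) tendsto_id
  refine tendsto_nhds_unique ((tendsto_eulerProd (R := R)).comp h5)
    ((((((tendsto_modFiveProd 1).mul (tendsto_modFiveProd 2)).mul
      (tendsto_modFiveProd 3)).mul (tendsto_modFiveProd 4)).mul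
      (tendsto_modFiveProd 5)).congr fun n => ?_)
  rw [Function.comp_apply]
  induction n with
  | zero => simp
  | succ n ih =>
    rw [show 5 * (n + 1) = 5 * n + 1 + 1 + 1 + 1 + 1 by omega]
    simp only [Finset.prod_range_succ]
    rw [← ih]
    ring

/-- The second Rogers-Ramanujan identity. -/
theorem tsum_rrTerm_one : ∑' k, rrTerm R 1 k = recip (∏' k, rrFactor R k) := by
  have hc : ∀ c : ℕ, c ≠ 0 → constantCoeff (modFiveProd R c) = 1 :=
    fun c hc => constantCoeff_modFiveProd hc
  rw [tprod_rrFactor]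
  refine eq_recip_of_mul_eq_one (by simp [hc]) ?_
  have h1 := eulerProd_mul_tsum_rrTerm (R := R) 1
  -- Passing to `rogersOne` at `0` empties `shiftedProd`, leaving a pure theta series.
  rw [← tsum_rogersOne 0] at h1
  have h2 : ∑' r, rogersOne R 0 r = ∑' r, thetaTerm (X : R⟦X⟧) (X ^ 4) r := by
    refine tsum_congr fun r => ?_
    simp only [rogersOne, thetaTerm, shiftedProd, Finset.range_zero, Finset.prod_empty]
    ring
  rw [h2, tsum_thetaTerm, eulerProd_eq_modFiveProd] at h1
  set A := modFiveProd R 1 * modFiveProd R 4 * modFiveProd R 5 with hA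
  have h3 := mul_recip A (by simp [hA, hc])
  linear_combination recip A * h1 +
    (1 - modFiveProd R 2 * modFiveProd R 3 * ∑' k, rrTerm R 1 k) * h3

end RogersRamanujan

/-! ### Reduction of the weighted sum to the Rogers-Ramanujan series. -/

section WeightedIdentity

variable {R : Type*} [CommRing R]

theorem one_sub_mul_qBracket (n : ℕ) : (1 - X) * qBracket R n = 1 - X ^ n :=
  mul_neg_geom_sum _ _

theorem constantCoeff_weightedFactor (t : R) {n : ℕ} (hn : n ≠ 0) :
    constantCoeff (weightedFactor t n) = 1 := by
  simp [weightedFactor, hn]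

theorem middleTerm_eq (t : R) (M : ℕ) {k : ℕ} (hk : 1 ≤ k) :
    middleTerm t M k =
      (1 - X ^ (M + 1)) * recip (weightedFactor t (M + 1)) * rrTerm R 1 k := by
  have h1 : qProd R 1 k = (1 - X) * qProd R 2 k := by
    rw [qProd, qProd, ← Finset.mul_prod_Ioc_eq_prod_Icc hk, pow_one]
    rfl
  have hX : constantCoeff (1 - X : R⟦X⟧) = 1 := by simp
  rw [middleTerm, rrTerm, h1, recip_mul hX (constantCoeff_qProd two_ne_zero k),
    ← one_sub_mul_qBracket]
  linear_combination -X ^ (k * (k + 1)) * recip (qProd R 2 k) * qBracket R (M + 1) *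
    recip (weightedFactor t (M + 1)) * mul_recip _ hX

/-- The weight replaces the factor `1 - q^(M+1)` of `(q)_k` by `1 - t q^(M+1)`. -/
theorem tailTerm_eq (t : R) (M : ℕ) {k : ℕ} (hk : M + 1 ≤ k) :
    tailTerm t M k =
      (1 - X ^ (M + 1)) * recip (weightedFactor t (M + 1)) * rrTerm R 1 k := by
  have h1 : qProd R 1 k = qProd R 1 M * qProd R (M + 2) k * (1 - X ^ (M + 1)) := by
    induction k, hk using Nat.le_induction with
    | base => rw [qProd_one_succ]; simp [qProd]
    | succ k hk ih =>
      rw [qProd_one_succ, ih, qProd, qProd, qProd, Finset.prod_Icc_succ_top (by omega)]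
      ring
  have hM : constantCoeff (1 - X ^ (M + 1) : R⟦X⟧) = 1 := constantCoeff_one_sub_X_pow (by omega)
  have hw := constantCoeff_weightedFactor t (n := M + 1) (by omega)
  have ha := constantCoeff_qProd (R := R) one_ne_zero M
  have hb := constantCoeff_qProd (R := R) (a := M + 2) (by omega) k
  rw [tailTerm, rrTerm, h1, recip_mul (by simp [ha, hw]) hb, recip_mul ha hw,
    recip_mul (by simp [ha, hb]) hM, recip_mul ha hb]
  linear_combination -X ^ (k * (k + 1)) * recip (qProd R 1 M) * recip (qProd R (M + 2) k) *
    recip (weightedFactor t (M + 1)) * mul_recip _ hM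

/-- The numerator is `[M+1]_q` with `q^(M-1)` replaced by `t q^(M-1)`. Times `q^2`, this change
turns `1 - t q^(M+1)` into `1 - q^(M+1)`. -/
theorem initial_terms_eq (t : R) {M : ℕ} (hM : 1 ≤ M) :
    1 + X ^ 2 * (firstNumerator t M * recip (weightedFactor t (M + 1))) =
      (1 - X ^ (M + 1)) * recip (weightedFactor t (M + 1)) *
        (rrTerm R 1 0 + rrTerm R 1 1) := by
  have hX : constantCoeff (1 - X : R⟦X⟧) = 1 := by simp
  have hw := mul_recip _ (constantCoeff_weightedFactor t (n := M + 1) (by omega))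
  have h0 : rrTerm R 1 0 = 1 := by
    rw [rrTerm, ← eq_recip_of_mul_eq_one (g := 1) (constantCoeff_qProd one_ne_zero 0)
      (by simp [qProd])]
    simp
  have h1 : rrTerm R 1 1 = X ^ 2 * recip (1 - X) := by simp [rrTerm, qProd]
  obtain ⟨m, rfl⟩ := Nat.exists_eq_add_of_le' hM
  have hb : qBracket R (m + 1 + 1) = qBracket R m + X ^ m + X ^ (m + 1) := by
    simp [qBracket, Finset.sum_range_succ]
  have hf : firstNumerator t (m + 1) = qBracket R m + C t * X ^ m + X ^ (m + 1) := by
    simp [firstNumerator]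
  have hg := one_sub_mul_qBracket (R := R) (m + 1 + 1)
  rw [h0, h1, ← hg, hf]
  rw [hb] at hg ⊢
  simp only [weightedFactor] at hw ⊢
  linear_combination -hw - recip (1 - C t * X ^ (m + 1 + 1)) * hg -
    X ^ 2 * recip (1 - C t * X ^ (m + 1 + 1)) * (qBracket R m + X ^ m + X ^ (m + 1)) *
      mul_recip _ hX

end WeightedIdentity

theorem mainTheorem3 {R : Type*} [CommRing R] [TopologicalSpace R] [DiscreteTopology R]
    (t : R) (M : ℕ) (hM : M + 1 ≡ 2 [MOD 5] ∨ M + 1 ≡ 3 [MOD 5]) :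
    Summable (fun j : ℕ => tailTerm t M (M + 1 + j)) ∧
    Multipliable (fun k : ℕ => rrFactor R k) ∧
    1 + X ^ 2 * (firstNumerator t M * recip (weightedFactor t (M + 1)))
        + ∑ k ∈ Finset.Icc 2 M, middleTerm t M k
        + ∑' j : ℕ, tailTerm t M (M + 1 + j)
      = (1 - X ^ (M + 1)) * recip (weightedFactor t (M + 1))
        * recip (∏' k : ℕ, rrFactor R k) := by
  -- The congruence excludes `M = 0`, where `M - 1` in `firstNumerator` would be truncated.
  have hM1 : 1 ≤ M := by
    rcases Nat.eq_zero_or_pos M with rfl | h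
    · exact absurd hM (by decide)
    · exact h
  have hs : Summable fun k => rrTerm R 1 k := summable_of_X_pow_dvd (X_pow_dvd_rrTerm 1)
  have hs' : Summable fun j => rrTerm R 1 (M + 1 + j) := by
    simpa only [add_comm] using (summable_nat_add_iff (M + 1)).2 hs
  have htail : (fun j => tailTerm t M (M + 1 + j)) = fun j =>
      (1 - X ^ (M + 1)) * recip (weightedFactor t (M + 1)) * rrTerm R 1 (M + 1 + j) :=
    funext fun j => tailTerm_eq t M (by omega)
  refine ⟨htail ▸ hs'.mul_left _, multipliable_rrFactor, ?_⟩
  have hsplit := hs.sum_add_tsum_nat_add (M + 1)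
  simp only [add_comm _ (M + 1)] at hsplit
  have hIcc : ∑ k ∈ Finset.range (M + 1), rrTerm R 1 k =
      rrTerm R 1 0 + rrTerm R 1 1 + ∑ k ∈ Finset.Icc 2 M, rrTerm R 1 k := by
    rw [← Finset.sum_range_add_sum_Ico _ (show 2 ≤ M + 1 by omega), Finset.sum_range_succ,
      Finset.sum_range_one]
    rfl
  rw [htail, hs'.tsum_mul_left, initial_terms_eq t hM1,
    Finset.sum_congr rfl fun k hk => middleTerm_eq t M (by have := (Finset.mem_Icc.1 hk).1; omega),
    ← Finset.mul_sum, ← tsum_rrTerm_one, ← hsplit, hIcc]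
  ring
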